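/- Let $n\ge 0$ and let $X\in\mathbb{R}^{n\times n}$. Write $\Sigma_{n\times n}$ for the set of doubly stochastic $n\times n$ matrices, $\langle S,X\rangle=\sum_{i,j}S_{ij}X_{ij}$, $\mathcal H(S)=-\sum_{i,j}S_{ij}\ln S_{ij}$ (with $0\ln 0=0$), and $\|\cdot\|$ for the Frobenius norm. For $\beta>0$ let $S^\beta_X$ be the unique maximiser over $S\in\Sigma_{n\times n}$ of $\langle S,X\rangle+\frac1\beta\mathcal H(S)$. Then the limit $S^\infty_X=\lim_{\beta\to\infty}S^\beta_X$ exists and maximises $\langle S,X\rangle$ over $\Sigma_{n\times n}$, and there are constants $c,\mu>0$, depending only on $X$ (not on $\beta$ or $\Delta\beta$), such that for all $\beta,\Delta\beta>0$ $$\|S^\beta_X-S^{\beta+\Delta\beta}_X\|\le\bigl(1-e^{-\mu\Delta\beta}\bigr)\frac{c}{\mu}\,e^{-\mu\beta}.$$ Moreover, with the same constants, $\|S^\beta_X-S^\infty_X\|\le\frac{c}{\mu}e^{-\mu\beta}$ for all $\beta>0$, so that the bounds for the consecutive differences and for the distance to $S^\infty_X$ decay at the same exponential rate. -/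

import Mathlib

open Filter Topology

/-- The linear assignment score `⟨S, X⟩ = ∑ i j, S i j * X i j`. -/
noncomputable def assignScore {n : ℕ} (S X : Matrix (Fin n) (Fin n) ℝ) : ℝ :=
  ∑ i, ∑ j, S i j * X i j

/-- The entropy `H(S) = -∑ i j, S i j * log (S i j)`, with `0 * log 0 = 0`. -/
noncomputable def matrixEntropy {n : ℕ} (S : Matrix (Fin n) (Fin n) ℝ) : ℝ :=
  -∑ i, ∑ j, S i j * Real.log (S i j)

/-- The entropy regularised assignment score `⟨S, X⟩ + (1/β) H(S)`. -/
noncomputable def entropicScore {n : ℕ} (β : ℝ) (X S : Matrix (Fin n) (Fin n) ℝ) : ℝ :=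
  assignScore S X + 1 / β * matrixEntropy S

/-- `S` maximises the linear assignment score over the doubly stochastic matrices. -/
def IsAssignmentSolution {n : ℕ} (X S : Matrix (Fin n) (Fin n) ℝ) : Prop :=
  S ∈ doublyStochastic ℝ (Fin n) ∧
    ∀ T ∈ doublyStochastic ℝ (Fin n), assignScore T X ≤ assignScore S X

/-- `S` maximises the regularised assignment score over the doubly stochastic matrices. -/
def IsSoftassign {n : ℕ} (β : ℝ) (X S : Matrix (Fin n) (Fin n) ℝ) : Prop :=
  S ∈ doublyStochastic ℝ (Fin n) ∧
    ∀ T ∈ doublyStochastic ℝ (Fin n), entropicScore β X T ≤ entropicScore β X S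

theorem continuous_entropicScore {n : ℕ} (β : ℝ) (X : Matrix (Fin n) (Fin n) ℝ) :
    Continuous (entropicScore β X) := by
  have h (i j : Fin n) : Continuous fun S : Matrix (Fin n) (Fin n) ℝ => S i j :=
    continuous_apply_apply i j
  unfold entropicScore assignScore matrixEntropy
  refine Continuous.add ?_ (continuous_const.mul (Continuous.neg ?_))
  · exact continuous_finsetSum _ fun i _ => continuous_finsetSum _ fun j _ =>
      (h i j).mul continuous_const
  · exact continuous_finsetSum _ fun i _ => continuous_finsetSum _ fun j _ =>
      Real.continuous_mul_log.comp (h i j)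

theorem isCompact_doublyStochastic (n : ℕ) :
    IsCompact (doublyStochastic ℝ (Fin n) : Set (Matrix (Fin n) (Fin n) ℝ)) := by
  have h (i j : Fin n) : Continuous fun S : Matrix (Fin n) (Fin n) ℝ => S i j :=
    continuous_apply_apply i j
  have hK : IsCompact (Set.univ.pi fun _ : Fin n => Set.univ.pi fun _ : Fin n =>
      Set.Icc (0 : ℝ) 1) :=
    isCompact_univ_pi fun _ => isCompact_univ_pi fun _ => isCompact_Icc
  refine hK.of_isClosed_subset ?_ ?_
  · have e : (doublyStochastic ℝ (Fin n) : Set (Matrix (Fin n) (Fin n) ℝ)) =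
        {S | (∀ i j, 0 ≤ S i j) ∧ (∀ i, ∑ j, S i j = 1) ∧ ∀ j, ∑ i, S i j = 1} := by
      ext S
      exact mem_doublyStochastic_iff_sum
    rw [e]
    simp only [Set.ofPred_and, Set.ofPred_forall]
    refine IsClosed.inter ?_ (IsClosed.inter ?_ ?_)
    · exact isClosed_iInter fun i => isClosed_iInter fun j => isClosed_le continuous_const (h i j)
    · exact isClosed_iInter fun i =>
        isClosed_eq (continuous_finsetSum _ fun j _ => h i j) continuous_const
    · exact isClosed_iInter fun j =>
        isClosed_eq (continuous_finsetSum _ fun i _ => h i j) continuous_const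
  · intro S hS i _ j _
    exact ⟨nonneg_of_mem_doublyStochastic hS, le_one_of_mem_doublyStochastic hS⟩

theorem exists_isSoftassign {n : ℕ} (β : ℝ) (X : Matrix (Fin n) (Fin n) ℝ) :
    ∃ S, IsSoftassign β X S := by
  obtain ⟨S, hS, hmax⟩ := (isCompact_doublyStochastic n).exists_isMaxOn ⟨1, one_mem _⟩
    (continuous_entropicScore β X).continuousOn
  exact ⟨S, hS, fun T hT => hmax hT⟩

/-- For `β > 0` the maximiser is unique. -/
theorem IsSoftassign.unique {n : ℕ} {β : ℝ} (hβ : 0 < β) {X S T : Matrix (Fin n) (Fin n) ℝ}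
    (hS : IsSoftassign β X S) (hT : IsSoftassign β X T) : S = T := by
  by_contra hne
  set M : Matrix (Fin n) (Fin n) ℝ := (1 / 2 : ℝ) • S + (1 / 2 : ℝ) • T with hM
  have hMmem : M ∈ doublyStochastic ℝ (Fin n) :=
    convex_doublyStochastic hS.1 hT.1 (by norm_num) (by norm_num) (by norm_num)
  have hentry (i j : Fin n) : M i j = (1 / 2 : ℝ) * S i j + (1 / 2 : ℝ) * T i j := by
    simp [hM]
  have hscore : assignScore M X = (1 / 2 : ℝ) * assignScore S X + (1 / 2 : ℝ) * assignScore T X := by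
    simp only [assignScore, hentry, Finset.mul_sum, ← Finset.sum_add_distrib]
    exact Finset.sum_congr rfl fun i _ => Finset.sum_congr rfl fun j _ => by ring
  have hle (i j : Fin n) : M i j * Real.log (M i j) ≤
      (1 / 2 : ℝ) * (S i j * Real.log (S i j)) + (1 / 2 : ℝ) * (T i j * Real.log (T i j)) := by
    rw [hentry]
    exact Real.strictConvexOn_mul_log.convexOn.2 (hS.1.1 i j) (hT.1.1 i j)
      (by norm_num) (by norm_num) (by norm_num)
  obtain ⟨i₀, j₀, hij⟩ : ∃ i j, S i j ≠ T i j := by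
    by_contra! h
    exact hne (Matrix.ext h)
  have hlt : M i₀ j₀ * Real.log (M i₀ j₀) <
      (1 / 2 : ℝ) * (S i₀ j₀ * Real.log (S i₀ j₀)) +
        (1 / 2 : ℝ) * (T i₀ j₀ * Real.log (T i₀ j₀)) := by
    rw [hentry]
    exact Real.strictConvexOn_mul_log.2 (hS.1.1 i₀ j₀) (hT.1.1 i₀ j₀) hij
      (by norm_num) (by norm_num) (by norm_num)
  have hent : (1 / 2 : ℝ) * matrixEntropy S + (1 / 2 : ℝ) * matrixEntropy T < matrixEntropy M := by
    have hsum : ∑ i, ∑ j, M i j * Real.log (M i j) <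
        ∑ i, ∑ j, ((1 / 2 : ℝ) * (S i j * Real.log (S i j)) +
          (1 / 2 : ℝ) * (T i j * Real.log (T i j))) :=
      Finset.sum_lt_sum (fun i _ => Finset.sum_le_sum fun j _ => hle i j)
        ⟨i₀, Finset.mem_univ _, Finset.sum_lt_sum (fun j _ => hle i₀ j)
          ⟨j₀, Finset.mem_univ _, hlt⟩⟩
    simp only [Finset.sum_add_distrib, ← Finset.mul_sum] at hsum
    simp only [matrixEntropy]
    linarith
  have h1 := hS.2 M hMmem
  have h2 := hT.2 M hMmem
  have h3 := mul_lt_mul_of_pos_left hent (one_div_pos.2 hβ)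
  simp only [entropicScore] at h1 h2
  linarith

/-- The matrix `S^β_X`: for `β > 0`, the unique maximiser of the regularised assignment score
over the doubly stochastic matrices. -/
noncomputable def softassign {n : ℕ} (β : ℝ) (X : Matrix (Fin n) (Fin n) ℝ) :
    Matrix (Fin n) (Fin n) ℝ :=
  Classical.choose (exists_isSoftassign β X)

theorem isSoftassign_softassign {n : ℕ} (β : ℝ) (X : Matrix (Fin n) (Fin n) ℝ) :
    IsSoftassign β X (softassign β X) :=
  Classical.choose_spec (exists_isSoftassign β X)

-- The norm of a matrix is the Frobenius norm.
attribute [local instance] Matrix.frobeniusNormedAddCommGroup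

/-! Stationarity says that `log S^β` pairs with each tangent direction `D` as `β X` does. Put `D =
S^β - S^β'` with `β ≤ β'` and subtract the two identities: `∑ D (log S^β - log S^β') = -(β' - β)⟨D,
X⟩`. The left side dominates `Q = ∑ D² / max(S^β, S^β')`, hence `‖D‖²`. On tangent directions `X`
acts as a matrix `g` supported on the entries that no optimal permutation uses (`exists_dual`), and
there `S^β` is exponentially small (`apply_le_exp`). Weighted Cauchy–Schwarz gives `⟨D, X⟩² ≤ const
· e^(-2μβ) · Q`, so `‖D‖ ≤ C (β' - β) e^(-μβ)`. Telescoping over unit steps turns this into a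
difference of exponentials, which yields the limit and both bounds. -/

/-- A matrix whose row and column sums vanish: a direction in the affine hull of the doubly
stochastic matrices. -/
def IsTangent {n : ℕ} (D : Matrix (Fin n) (Fin n) ℝ) : Prop :=
  (∀ i, ∑ j, D i j = 0) ∧ ∀ j, ∑ i, D i j = 0

theorem isTangent_sub {n : ℕ} {S T : Matrix (Fin n) (Fin n) ℝ}
    (hS : S ∈ doublyStochastic ℝ (Fin n)) (hT : T ∈ doublyStochastic ℝ (Fin n)) :
    IsTangent (S - T) := by
  rw [mem_doublyStochastic_iff_sum] at hS hT
  constructor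
  · intro i
    simp [Finset.sum_sub_distrib, hS.2.1, hT.2.1]
  · intro j
    simp [Finset.sum_sub_distrib, hS.2.2, hT.2.2]

theorem eventually_add_smul_mem_doublyStochastic {n : ℕ} {S D : Matrix (Fin n) (Fin n) ℝ}
    (hS : S ∈ doublyStochastic ℝ (Fin n)) (hD : IsTangent D)
    (h : ∀ i j, S i j = 0 → D i j = 0) :
    ∀ᶠ ε : ℝ in 𝓝 0, S + ε • D ∈ doublyStochastic ℝ (Fin n) := by
  rw [mem_doublyStochastic_iff_sum] at hS
  have key : ∀ i j, ∀ᶠ ε : ℝ in 𝓝 0, 0 ≤ S i j + ε * D i j := by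
    intro i j
    rcases (hS.1 i j).eq_or_lt with h0 | h0
    · exact Eventually.of_forall fun ε => by rw [h i j h0.symm, ← h0]; simp
    · have hc : Tendsto (fun ε : ℝ => S i j + ε * D i j) (𝓝 0) (𝓝 (S i j)) := by
        have : Continuous fun ε : ℝ => S i j + ε * D i j := by fun_prop
        simpa using this.tendsto 0
      exact (hc.eventually (lt_mem_nhds h0)).mono fun _ h => h.le
  filter_upwards [eventually_all.2 fun i => eventually_all.2 (key i)] with ε hε
  rw [mem_doublyStochastic_iff_sum]
  refine ⟨fun i j => by simpa using hε i j, fun i => ?_, fun j => ?_⟩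
  · simp [Finset.sum_add_distrib, ← Finset.mul_sum, hS.2.1, hD.1]
  · simp [Finset.sum_add_distrib, ← Finset.mul_sum, hS.2.2, hD.2]

theorem assignScore_add {n : ℕ} (S T X : Matrix (Fin n) (Fin n) ℝ) :
    assignScore (S + T) X = assignScore S X + assignScore T X := by
  simp [assignScore, add_mul, Finset.sum_add_distrib]

theorem assignScore_smul {n : ℕ} (a : ℝ) (S X : Matrix (Fin n) (Fin n) ℝ) :
    assignScore (a • S) X = a * assignScore S X := by
  simp [assignScore, Finset.mul_sum, mul_assoc]

theorem assignScore_sum {n : ℕ} {ι : Type*} (s : Finset ι) (f : ι → Matrix (Fin n) (Fin n) ℝ)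
    (X : Matrix (Fin n) (Fin n) ℝ) :
    assignScore (∑ k ∈ s, f k) X = ∑ k ∈ s, assignScore (f k) X := by
  classical
  induction s using Finset.induction_on with
  | empty => simp [assignScore]
  | insert a s ha ih => rw [Finset.sum_insert ha, Finset.sum_insert ha, assignScore_add, ih]

theorem matrixEntropy_eq_sum_negMulLog {n : ℕ} (S : Matrix (Fin n) (Fin n) ℝ) :
    matrixEntropy S = ∑ i, ∑ j, Real.negMulLog (S i j) := by
  simp [matrixEntropy, Real.negMulLog]

theorem IsAssignmentSolution.assignScore_eq_zero {n : ℕ} {X S D : Matrix (Fin n) (Fin n) ℝ}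
    (hS : IsAssignmentSolution X S) (hD : IsTangent D) (h : ∀ i j, S i j = 0 → D i j = 0) :
    assignScore D X = 0 := by
  have hmax : IsLocalMax (fun ε : ℝ => assignScore S X + ε * assignScore D X) 0 := by
    filter_upwards [eventually_add_smul_mem_doublyStochastic hS.1 hD h] with ε hε
    simpa [assignScore_add, assignScore_smul] using hS.2 _ hε
  have hder : HasDerivAt (fun ε : ℝ => assignScore S X + ε * assignScore D X)
      (assignScore D X) 0 := by
    simpa using ((hasDerivAt_id (0 : ℝ)).mul_const (assignScore D X)).const_add (assignScore S X)
  exact hmax.hasDerivAt_eq_zero hder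

/-! ### Positivity and stationarity of the regularised maximiser -/

theorem uniform_mem_doublyStochastic {n : ℕ} :
    (Matrix.of fun _ _ => (n : ℝ)⁻¹ : Matrix (Fin n) (Fin n) ℝ) ∈
      doublyStochastic ℝ (Fin n) := by
  rw [mem_doublyStochastic_iff_sum]
  refine ⟨fun i j => by simp, fun i => ?_, fun i => ?_⟩ <;>
  · have : (n : ℝ) ≠ 0 := by exact_mod_cast (Fin.pos i).ne'
    simp [this]

/-- Entropy has infinite slope at a zero entry: mixing in `ε` of the uniform matrix gains at least
`ε log(1/ε) / (β n)` there and costs only `O(ε)`. -/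
theorem IsSoftassign.pos {n : ℕ} {β : ℝ} (hβ : 0 < β) {X S : Matrix (Fin n) (Fin n) ℝ}
    (hS : IsSoftassign β X S) (i j : Fin n) : 0 < S i j := by
  refine lt_of_le_of_ne (hS.1.1 i j) fun h0 => ?_
  have hn : (0 : ℝ) < n := by exact_mod_cast Fin.pos i
  set U : Matrix (Fin n) (Fin n) ℝ := Matrix.of fun _ _ => (n : ℝ)⁻¹ with hU
  have hUm : U ∈ doublyStochastic ℝ (Fin n) := uniform_mem_doublyStochastic
  have hUp : ∀ k l, 0 ≤ U k l := hUm.1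
  have hUij : U i j = (n : ℝ)⁻¹ := rfl
  have key : ∀ ε : ℝ, 0 < ε → ε < 1 →
      1 / β * ((n : ℝ)⁻¹ * -Real.log ε) ≤ entropicScore β X S - entropicScore β X U := by
    intro ε h1 h2
    have hm : (1 - ε) • S + ε • U ∈ doublyStochastic ℝ (Fin n) :=
      convex_doublyStochastic hS.1 hUm (by linarith) h1.le (by ring)
    have hent : ∀ k l, (1 - ε) * Real.negMulLog (S k l) + ε * Real.negMulLog (U k l) +
        (if k = i ∧ l = j then ε * ((n : ℝ)⁻¹ * -Real.log ε) else 0) ≤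
        Real.negMulLog (((1 - ε) • S + ε • U) k l) := by
      intro k l
      have e : ((1 - ε) • S + ε • U) k l = (1 - ε) * S k l + ε * U k l := by simp
      rw [e]
      split_ifs with hkl
      · obtain ⟨rfl, rfl⟩ := hkl
        rw [← h0, hUij, mul_zero, zero_add, Real.negMulLog_mul, Real.negMulLog_zero]
        simp only [Real.negMulLog]
        linarith
      · rw [add_zero]
        exact Real.concaveOn_negMulLog.2 (hS.1.1 k l) (hUp k l) (by linarith) h1.le (by ring)
    have hsum := Finset.sum_le_sum fun k (_ : k ∈ Finset.univ) =>
      Finset.sum_le_sum fun l (_ : l ∈ Finset.univ) => hent k l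
    have hone : ∑ k : Fin n, ∑ l : Fin n,
        (if k = i ∧ l = j then ε * ((n : ℝ)⁻¹ * -Real.log ε) else 0) =
        ε * ((n : ℝ)⁻¹ * -Real.log ε) := by
      simp [ite_and]
    simp only [Finset.sum_add_distrib, ← Finset.mul_sum] at hsum
    rw [hone, ← matrixEntropy_eq_sum_negMulLog, ← matrixEntropy_eq_sum_negMulLog,
      ← matrixEntropy_eq_sum_negMulLog] at hsum
    have hle := hS.2 _ hm
    simp only [entropicScore, assignScore_add, assignScore_smul] at hle ⊢
    have := mul_le_mul_of_nonneg_left hsum (one_div_pos.2 hβ).le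
    refine le_of_mul_le_mul_left ?_ h1
    nlinarith
  set C := entropicScore β X S - entropicScore β X U
  have hC := key (Real.exp (-(β * n * (|C| + 1)))) (Real.exp_pos _)
    (Real.exp_lt_one_iff.2 (neg_lt_zero.2 (by positivity)))
  rw [Real.log_exp] at hC
  have e : 1 / β * ((n : ℝ)⁻¹ * - -(β * n * (|C| + 1))) = |C| + 1 := by field_simp
  have := le_abs_self C
  linarith

theorem IsSoftassign.sum_mul_log {n : ℕ} {β : ℝ} (hβ : 0 < β) {X S D : Matrix (Fin n) (Fin n) ℝ}
    (hS : IsSoftassign β X S) (hD : IsTangent D) :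
    ∑ i, ∑ j, D i j * Real.log (S i j) = β * assignScore D X := by
  have hpos := hS.pos hβ
  have hmax : IsLocalMax (fun ε : ℝ => assignScore S X + ε * assignScore D X +
      1 / β * ∑ i, ∑ j, Real.negMulLog (S i j + ε * D i j)) 0 := by
    filter_upwards [eventually_add_smul_mem_doublyStochastic hS.1 hD
      fun i j h => absurd h (hpos i j).ne'] with ε hε
    simpa [entropicScore, assignScore_add, assignScore_smul, matrixEntropy_eq_sum_negMulLog]
      using hS.2 _ hε
  have hent (i j : Fin n) : HasDerivAt (fun ε : ℝ => Real.negMulLog (S i j + ε * D i j))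
      ((-Real.log (S i j) - 1) * D i j) 0 := by
    have h1 : HasDerivAt (fun ε : ℝ => S i j + ε * D i j) (D i j) 0 := by
      simpa using ((hasDerivAt_id (0 : ℝ)).mul_const (D i j)).const_add (S i j)
    have h2 : HasDerivAt Real.negMulLog (-Real.log (S i j) - 1) (S i j + 0 * D i j) := by
      simpa using Real.hasDerivAt_negMulLog (hpos i j).ne'
    exact h2.comp (0 : ℝ) h1
  have hlin : HasDerivAt (fun ε : ℝ => assignScore S X + ε * assignScore D X)
      (assignScore D X) 0 := by
    simpa using ((hasDerivAt_id (0 : ℝ)).mul_const (assignScore D X)).const_add (assignScore S X)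
  have hder := hlin.add ((HasDerivAt.fun_sum fun i (_ : i ∈ Finset.univ) =>
    HasDerivAt.fun_sum fun j (_ : j ∈ Finset.univ) => hent i j).const_mul (1 / β))
  have h0 := hmax.hasDerivAt_eq_zero hder
  have hexp : ∑ i, ∑ j, (-Real.log (S i j) - 1) * D i j =
      -∑ i, ∑ j, D i j * Real.log (S i j) := by
    have : ∀ i j, (-Real.log (S i j) - 1) * D i j = -(D i j * Real.log (S i j)) - D i j :=
      fun i j => by ring
    simp [this, Finset.sum_sub_distrib, hD.1]
  rw [hexp] at h0
  field_simp at h0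
  linarith

/-- From `log t ≤ t - 1` at `t = min / max`. The weight `1 / max` is kept because Cauchy–Schwarz
later exploits it on small entries. -/
theorem sq_div_max_le_sub_mul_log_sub_log {a b : ℝ} (ha : 0 < a) (hb : 0 < b) :
    (a - b) ^ 2 / max a b ≤ (a - b) * (Real.log a - Real.log b) := by
  have key : ∀ {a b : ℝ}, 0 < a → 0 < b → b ≤ a →
      (a - b) ^ 2 / max a b ≤ (a - b) * (Real.log a - Real.log b) := by
    intro a b ha hb hab
    rw [max_eq_left hab]
    have h1 := Real.log_le_sub_one_of_pos (div_pos hb ha)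
    rw [Real.log_div hb.ne' ha.ne'] at h1
    have e : (a - b) ^ 2 / a = (a - b) * (1 - b / a) := by field_simp
    rw [e]
    exact mul_le_mul_of_nonneg_left (by linarith) (by linarith)
  rcases le_total b a with h | h
  · exact key ha hb h
  · have := key hb ha h
    rw [max_comm]
    linarith [show (a - b) ^ 2 = (b - a) ^ 2 by ring,
      show (a - b) * (Real.log a - Real.log b) = (b - a) * (Real.log b - Real.log a) by ring,
      show (a - b) ^ 2 / max b a = (b - a) ^ 2 / max b a by rw [show (a - b) ^ 2 = (b - a) ^ 2 by ring]]

theorem frobenius_norm_sq {n : ℕ} (D : Matrix (Fin n) (Fin n) ℝ) :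
    ‖D‖ ^ 2 = ∑ i, ∑ j, D i j ^ 2 := by
  rw [Matrix.frobenius_norm_def, ← Real.sqrt_eq_rpow, Real.sq_sqrt]
  · simp
  · positivity

theorem permMatrix_apply_eq_ite {n : ℕ} (σ : Equiv.Perm (Fin n)) (i j : Fin n) :
    σ.permMatrix ℝ i j = if σ i = j then 1 else 0 := by
  simp [Equiv.Perm.permMatrix, PEquiv.toMatrix_apply, Equiv.toPEquiv_apply]

theorem sum_permMatrix_mul {n : ℕ} (σ : Equiv.Perm (Fin n)) (A : Fin n → Fin n → ℝ) :
    ∑ i, ∑ j, σ.permMatrix ℝ i j * A i j = ∑ i, A i (σ i) := by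
  simp

/-! ### Exponential decay off the optimal face -/

/-- If every permutation through the entry `(i, j)` misses the optimal score by at least `d`, then
this entry of the softassign matrix decays exponentially in `β`. -/
theorem IsSoftassign.apply_le_exp {n : ℕ} {β : ℝ} (hβ : 0 < β) {X S : Matrix (Fin n) (Fin n) ℝ}
    (hS : IsSoftassign β X S) {i j : Fin n} {d : ℝ} {τ : Equiv.Perm (Fin n)}
    (h : ∀ σ : Equiv.Perm (Fin n), σ i = j →
      assignScore (σ.permMatrix ℝ) X + d ≤ assignScore (τ.permMatrix ℝ) X) :
    S i j ≤ n.factorial * Real.exp (-(β * d / (n + 1))) := by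
  have hpos := hS.pos hβ
  obtain ⟨w, hw0, hw1, hwS⟩ := exists_eq_sum_perm_of_mem_doublyStochastic hS.1
  have happ : ∀ k l, S k l = ∑ σ : Equiv.Perm (Fin n), if σ k = l then w σ else 0 := by
    intro k l
    rw [← hwS, Matrix.sum_apply]
    simp
  have hfac : (0 : ℝ) < n.factorial := by exact_mod_cast n.factorial_pos
  -- Pigeonhole over the `n!` Birkhoff weights: some `σ` through `(i, j)` has weight at least `S i j
  -- / n!`, which bounds every `S k (σ k)` from below.
  obtain ⟨σ, hσ⟩ : ∃ σ : Equiv.Perm (Fin n),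
      S i j / n.factorial ≤ if σ i = j then w σ else 0 := by
    by_contra! hlt
    have := Finset.sum_lt_sum_of_nonempty Finset.univ_nonempty
      fun (σ : Equiv.Perm (Fin n)) _ => hlt σ
    rw [← happ, Finset.sum_const, Finset.card_univ, Fintype.card_perm, Fintype.card_fin,
      nsmul_eq_mul, mul_div_cancel₀ _ hfac.ne'] at this
    exact this.false
  set p := S i j / n.factorial with hp
  have hp0 : 0 < p := div_pos (hpos i j) hfac
  have hσij : σ i = j := by
    by_contra hne
    rw [if_neg hne] at hσ
    linarith
  rw [if_pos hσij] at hσ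
  have hle : ∀ k, p ≤ S k (σ k) := by
    intro k
    rw [happ]
    have := Finset.single_le_sum (f := fun ρ : Equiv.Perm (Fin n) => if ρ k = σ k then w ρ else 0)
      (fun ρ _ => by split_ifs; exacts [hw0 ρ, le_rfl]) (Finset.mem_univ σ)
    simp only [if_true] at this
    linarith
  have hfirst := hS.sum_mul_log hβ (isTangent_sub (permMatrix_mem_doublyStochastic (σ := τ))
    (permMatrix_mem_doublyStochastic (σ := σ)))
  have hsc : assignScore (τ.permMatrix ℝ - σ.permMatrix ℝ) X =
      assignScore (τ.permMatrix ℝ) X - assignScore (σ.permMatrix ℝ) X := by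
    simp [assignScore, sub_mul, Finset.sum_sub_distrib]
  simp only [Matrix.sub_apply, sub_mul, Finset.sum_sub_distrib, sum_permMatrix_mul] at hfirst
  rw [hsc] at hfirst
  have h1 : ∑ k, Real.log (S k (τ k)) ≤ 0 :=
    Finset.sum_nonpos fun k _ => Real.log_nonpos (hpos _ _).le
      (le_one_of_mem_doublyStochastic hS.1)
  have h2 : n * Real.log p ≤ ∑ k, Real.log (S k (σ k)) := by
    have := Finset.sum_le_sum fun k (_ : k ∈ Finset.univ) => Real.log_le_log hp0 (hle k)
    simpa using this
  have h3 : Real.log p ≤ 0 := Real.log_nonpos hp0.le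
    ((hle i).trans (le_one_of_mem_doublyStochastic hS.1))
  have h4 := mul_le_mul_of_nonneg_left (h σ hσij) hβ.le
  -- Stationarity along `τ - σ` gives `n log p ≤ -β d`. Weakening `n` to `n + 1` keeps the rate
  -- meaningful when `n = 0`.
  have h5 : Real.log p ≤ -(β * d / (n + 1)) := by
    rw [← neg_div, le_div_iff₀ (by positivity)]
    nlinarith
  have h6 := (Real.log_le_iff_le_exp hp0).1 h5
  rw [hp, div_le_iff₀ hfac] at h6
  linarith

/-- The score vanishes wherever all row sums, column sums and entries at zeros of `S` vanish, so it
is a linear combination of these functionals. On tangent directions only the entry functionals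
survive; their coefficients form `g`. -/
theorem IsAssignmentSolution.exists_dual {n : ℕ} {X S : Matrix (Fin n) (Fin n) ℝ}
    (hS : IsAssignmentSolution X S) :
    ∃ g : Matrix (Fin n) (Fin n) ℝ, (∀ i j, S i j ≠ 0 → g i j = 0) ∧
      ∀ D, IsTangent D → assignScore D X = ∑ i, ∑ j, g i j * D i j := by
  let e (i j : Fin n) : Matrix (Fin n) (Fin n) ℝ →ₗ[ℝ] ℝ := Matrix.entryLinearMap ℝ ℝ i j
  let L : Fin n ⊕ Fin n ⊕ {p : Fin n × Fin n // S p.1 p.2 = 0} →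
      Matrix (Fin n) (Fin n) ℝ →ₗ[ℝ] ℝ :=
    Sum.elim (fun i => ∑ j, e i j) (Sum.elim (fun j => ∑ i, e i j) fun p => e p.1.1 p.1.2)
  let K : Matrix (Fin n) (Fin n) ℝ →ₗ[ℝ] ℝ :=
    { toFun := fun D => assignScore D X
      map_add' := fun D E => assignScore_add D E X
      map_smul' := fun a D => assignScore_smul a D X }
  have hK : K ∈ Submodule.span ℝ (Set.range L) := by
    refine mem_span_of_iInf_ker_le_ker fun D hD => ?_
    simp only [Submodule.mem_iInf, LinearMap.mem_ker] at hD ⊢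
    refine hS.assignScore_eq_zero ⟨fun i => ?_, fun j => ?_⟩ fun i j hij => ?_
    · simpa [L, e] using hD (Sum.inl i)
    · simpa [L, e] using hD (Sum.inr (Sum.inl j))
    · simpa [L, e] using hD (Sum.inr (Sum.inr ⟨(i, j), hij⟩))
  obtain ⟨c, hc⟩ := (Submodule.mem_span_range_iff_exists_fun ℝ).1 hK
  refine ⟨Matrix.of fun i j => if h : S i j = 0 then c (Sum.inr (Sum.inr ⟨(i, j), h⟩)) else 0,
    fun i j h => by simp [h], fun D hD => ?_⟩
  have h1 : assignScore D X = K D := rfl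
  rw [h1, ← hc, LinearMap.sum_apply, Fintype.sum_sum_type, Fintype.sum_sum_type]
  have hr : ∀ i, L (Sum.inl i) D = 0 := fun i => by simpa [L, e] using hD.1 i
  have hcol : ∀ i, L (Sum.inr (Sum.inl i)) D = 0 := fun i => by simpa [L, e] using hD.2 i
  simp only [LinearMap.smul_apply, hr, hcol, smul_zero, Finset.sum_const_zero, zero_add]
  rw [← Fintype.sum_prod_type' (f := fun i j : Fin n => (Matrix.of fun i j =>
    if h : S i j = 0 then c (Sum.inr (Sum.inr ⟨(i, j), h⟩)) else 0) i j * D i j)]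
  rw [← Finset.sum_subset (Finset.subset_univ
    (Finset.univ.filter fun p : Fin n × Fin n => S p.1 p.2 = 0))
    (fun p _ hp => by
      have : S p.1 p.2 ≠ 0 := by simpa using hp
      simp [this])]
  rw [Finset.sum_subtype (p := fun p : Fin n × Fin n => S p.1 p.2 = 0) _ (by simp)]
  exact Finset.sum_congr rfl fun p _ => by simp [L, e, p.2]

/-- There is an optimal assignment all of whose zero entries are missed, with a uniform gap, by the
(near-)optimal permutations. -/
theorem exists_isAssignmentSolution_gap {n : ℕ} (X : Matrix (Fin n) (Fin n) ℝ) :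
    ∃ (S : Matrix (Fin n) (Fin n) ℝ) (τ : Equiv.Perm (Fin n)) (d : ℝ), 0 < d ∧
      IsAssignmentSolution X S ∧ ∀ i j, S i j = 0 → ∀ σ : Equiv.Perm (Fin n), σ i = j →
        assignScore (σ.permMatrix ℝ) X + d ≤ assignScore (τ.permMatrix ℝ) X := by
  classical
  let s : Equiv.Perm (Fin n) → ℝ := fun σ => assignScore (σ.permMatrix ℝ) X
  obtain ⟨τ, hτ⟩ := Finite.exists_max s
  let O : Finset (Equiv.Perm (Fin n)) := Finset.univ.filter fun σ => s σ = s τ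
  have hO : O.Nonempty := ⟨τ, by simp [O]⟩
  have hOc : (0 : ℝ) < O.card := by exact_mod_cast hO.card_pos
  have hgap : ∃ d : ℝ, 0 < d ∧ ∀ σ, σ ∉ O → s σ + d ≤ s τ := by
    have : ∀ σ, ∀ᶠ d in 𝓝[>] (0 : ℝ), σ ∉ O → s σ + d ≤ s τ := by
      intro σ
      by_cases hσ : σ ∈ O
      · exact Eventually.of_forall fun d h => absurd hσ h
      · have hne : s σ ≠ s τ := by simpa [O] using hσ
        have hlt := sub_pos.2 (lt_of_le_of_ne (hτ σ) hne)
        filter_upwards [Ioo_mem_nhdsGT hlt] with d hd _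
        linarith [hd.2]
    obtain ⟨d, hd, hd0⟩ := ((eventually_all.2 this).and self_mem_nhdsWithin).exists
    exact ⟨d, hd0, hd⟩
  obtain ⟨d, hd, hgap⟩ := hgap
  -- The barycentre of the optimal permutations: an entry of it is zero only if every optimal
  -- permutation misses it.
  let S : Matrix (Fin n) (Fin n) ℝ := ∑ σ ∈ O, (O.card : ℝ)⁻¹ • σ.permMatrix ℝ
  have hSm : S ∈ doublyStochastic ℝ (Fin n) :=
    convex_doublyStochastic.sum_mem (fun _ _ => by positivity) (by simp [hOc.ne'])
      fun σ _ => permMatrix_mem_doublyStochastic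
  have hSs : assignScore S X = s τ := by
    rw [assignScore_sum]
    simp only [assignScore_smul]
    rw [Finset.sum_congr rfl fun σ hσ => show _ = (O.card : ℝ)⁻¹ * s τ by
      rw [← (Finset.mem_filter.1 hσ).2]]
    simp [hOc.ne']
  refine ⟨S, τ, d, hd, ⟨hSm, fun T hT => ?_⟩, fun i j hij σ hσ => hgap σ fun hσO => ?_⟩
  · obtain ⟨w, hw0, hw1, rfl⟩ := exists_eq_sum_perm_of_mem_doublyStochastic hT
    rw [hSs, assignScore_sum]
    simp only [assignScore_smul]
    calc _ ≤ ∑ σ, w σ * s τ :=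
          Finset.sum_le_sum fun σ _ => mul_le_mul_of_nonneg_left (hτ σ) (hw0 σ)
      _ = s τ := by rw [← Finset.sum_mul, hw1, one_mul]
  · have hle := Finset.single_le_sum
      (f := fun ρ : Equiv.Perm (Fin n) => ((O.card : ℝ)⁻¹ • ρ.permMatrix ℝ) i j)
      (fun ρ _ => by
        simp only [Matrix.smul_apply, permMatrix_apply_eq_ite]
        split_ifs <;> simp) hσO
    simp only [← Matrix.sum_apply] at hle
    change _ ≤ S i j at hle
    rw [hij, Matrix.smul_apply, permMatrix_apply_eq_ite, if_pos hσ] at hle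
    have : (0 : ℝ) < (O.card : ℝ)⁻¹ := inv_pos.2 hOc
    simp only [smul_eq_mul, mul_one] at hle
    linarith

/-! ### Local Lipschitz estimate in `β` -/

theorem exists_norm_softassign_sub_le {n : ℕ} (X : Matrix (Fin n) (Fin n) ℝ) :
    ∃ C μ : ℝ, 0 < C ∧ 0 < μ ∧ ∀ β β' : ℝ, 0 < β → β ≤ β' →
      ‖softassign β X - softassign β' X‖ ≤ C * (β' - β) * Real.exp (-μ * β) := by
  obtain ⟨S, τ, d, hd, hS, hgap⟩ := exists_isAssignmentSolution_gap X
  obtain ⟨g, hg0, hg⟩ := hS.exists_dual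
  set G : ℝ := ∑ i, ∑ j, g i j ^ 2 with hG
  have hG0 : 0 ≤ G := by positivity
  have hfac : (0 : ℝ) < n.factorial := by exact_mod_cast n.factorial_pos
  -- The rate is half that of the entries, since the estimate is on `‖D‖²`; the `+ 1` only ensures
  -- positivity.
  refine ⟨Real.sqrt (G * n.factorial) + 1, d / (2 * (n + 1)), by positivity, by positivity,
    fun β β' hβ hle => ?_⟩
  have hβ' := hβ.trans_le hle
  have hA := isSoftassign_softassign β X
  have hB := isSoftassign_softassign β' X
  set A := softassign β X
  set B := softassign β' X
  have hApos := hA.pos hβ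
  have hBpos := hB.pos hβ'
  set D := A - B with hDdef
  have hD : IsTangent D := isTangent_sub hA.1 hB.1
  set E := Real.exp (-(d / (2 * (n + 1))) * β) with hE
  have hE0 : 0 < E := Real.exp_pos _
  have hE2 : E ^ 2 = Real.exp (-(β * d / (n + 1))) := by
    rw [hE, ← Real.exp_nat_mul]
    congr 1
    field_simp
    ring
  set M : Matrix (Fin n) (Fin n) ℝ := Matrix.of fun i j => max (A i j) (B i j) with hM
  have hMpos : ∀ i j, 0 < M i j := fun i j => lt_max_of_lt_left (hApos i j)
  have hMone : ∀ i j, M i j ≤ 1 := fun i j =>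
    max_le (le_one_of_mem_doublyStochastic hA.1) (le_one_of_mem_doublyStochastic hB.1)
  have hMZ : ∀ i j, S i j = 0 → M i j ≤ n.factorial * E ^ 2 := by
    intro i j hij
    rw [hE2]
    refine max_le (hA.apply_le_exp hβ (hgap i j hij))
      ((hB.apply_le_exp hβ' (hgap i j hij)).trans ?_)
    gcongr
  set Q : ℝ := ∑ i, ∑ j, D i j ^ 2 / M i j with hQ
  have hQ0 : 0 ≤ Q := Finset.sum_nonneg fun i _ => Finset.sum_nonneg fun j _ =>
    div_nonneg (sq_nonneg _) (hMpos i j).le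
  have hnorm : ‖D‖ ^ 2 ≤ Q := by
    rw [frobenius_norm_sq]
    refine Finset.sum_le_sum fun i _ => Finset.sum_le_sum fun j _ => ?_
    rw [le_div_iff₀ (hMpos i j)]
    exact mul_le_of_le_one_right (sq_nonneg _) (hMone i j)
  have hQle : Q ≤ (β' - β) * -assignScore D X := by
    have h1 := hA.sum_mul_log hβ hD
    have h2 := hB.sum_mul_log hβ' hD
    have h3 : Q ≤ ∑ i, ∑ j, D i j * (Real.log (A i j) - Real.log (B i j)) :=
      Finset.sum_le_sum fun i _ => Finset.sum_le_sum fun j _ =>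
        sq_div_max_le_sub_mul_log_sub_log (hApos i j) (hBpos i j)
    simp only [mul_sub, Finset.sum_sub_distrib] at h3
    rw [h1, h2] at h3
    linarith
  -- Split `g D` as `(g √M)(D / √M)`; `g` lives where `M` is exponentially small.
  have hCS : (assignScore D X) ^ 2 ≤ (G * n.factorial * E ^ 2) * Q := by
    rw [hg D hD, hQ, ← Fintype.sum_prod_type' (f := fun i j => g i j * D i j),
      ← Fintype.sum_prod_type' (f := fun i j => D i j ^ 2 / M i j)]
    have h1 : G * n.factorial * E ^ 2 =
        ∑ p : Fin n × Fin n, g p.1 p.2 ^ 2 * (n.factorial * E ^ 2) := by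
      rw [hG, ← Finset.sum_mul, ← Fintype.sum_prod_type' (f := fun i j => g i j ^ 2), mul_assoc]
    have h2 : ∑ p : Fin n × Fin n, g p.1 p.2 ^ 2 * M p.1 p.2 ≤ G * n.factorial * E ^ 2 := by
      rw [h1]
      refine Finset.sum_le_sum fun p _ => ?_
      by_cases hp : S p.1 p.2 = 0
      · exact mul_le_mul_of_nonneg_left (hMZ _ _ hp) (sq_nonneg _)
      · simp [hg0 _ _ hp]
    refine le_trans (Finset.sum_sq_le_sum_mul_sum_of_sq_le_mul _
      (fun p _ => mul_nonneg (sq_nonneg _) (hMpos p.1 p.2).le)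
      (fun p _ => div_nonneg (sq_nonneg _) (hMpos p.1 p.2).le) fun p _ => le_of_eq ?_)
      (mul_le_mul_of_nonneg_right h2 (Finset.sum_nonneg fun p _ =>
        div_nonneg (sq_nonneg _) (hMpos p.1 p.2).le))
    have := (hMpos p.1 p.2).ne'
    field_simp
  have hQbound : Q ≤ (β' - β) ^ 2 * (G * n.factorial * E ^ 2) := by
    rcases hQ0.eq_or_lt with h | h
    · rw [← h]; positivity
    · refine le_of_mul_le_mul_right ?_ h
      calc Q * Q ≤ ((β' - β) * -assignScore D X) * ((β' - β) * -assignScore D X) :=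
            mul_self_le_mul_self hQ0 hQle
        _ = (β' - β) ^ 2 * (assignScore D X) ^ 2 := by ring
        _ ≤ (β' - β) ^ 2 * ((G * n.factorial * E ^ 2) * Q) := by gcongr
        _ = _ := by ring
  have hsub : 0 ≤ β' - β := sub_nonneg.2 hle
  have hfinal : ‖D‖ ≤ Real.sqrt (G * n.factorial) * (β' - β) * E := by
    refine abs_le_of_sq_le_sq' ?_ (by positivity) |>.2
    rw [mul_pow, mul_pow, Real.sq_sqrt (by positivity)]
    linarith
  refine hfinal.trans ?_
  gcongr
  linarith

/-! ### Telescoping and passage to the limit -/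

/-- For steps of length at most 1, `x = μ(β' - β)` satisfies `x ≤ e^μ (1 - e^(-x))`, at the price of
the factor `e^μ`. The resulting bound telescopes over longer intervals. -/
theorem norm_sub_le_exp_sub_exp {E : Type*} [SeminormedAddCommGroup E] {f : ℝ → E} {C μ : ℝ}
    (hC : 0 ≤ C) (hμ : 0 < μ)
    (h : ∀ β β' : ℝ, 0 < β → β ≤ β' → ‖f β - f β'‖ ≤ C * (β' - β) * Real.exp (-μ * β))
    {β β' : ℝ} (hβ : 0 < β) (hle : β ≤ β') :
    ‖f β - f β'‖ ≤ C * Real.exp μ / μ * (Real.exp (-μ * β) - Real.exp (-μ * β')) := by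
  have short : ∀ β β' : ℝ, 0 < β → β ≤ β' → β' ≤ β + 1 →
      ‖f β - f β'‖ ≤ C * Real.exp μ / μ * (Real.exp (-μ * β) - Real.exp (-μ * β')) := by
    intro β β' hβ hle h1
    refine (h β β' hβ hle).trans ?_
    set x := μ * (β' - β) with hx
    have hx0 : 0 ≤ x := mul_nonneg hμ.le (sub_nonneg.2 hle)
    have hxμ : x ≤ μ := by nlinarith
    have e1 : Real.exp (-μ * β') = Real.exp (-μ * β) * Real.exp (-x) := by
      rw [← Real.exp_add]; congr 1; rw [hx]; ring
    have e2 : x ≤ Real.exp μ * (1 - Real.exp (-x)) := by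
      have h2 : x ≤ Real.exp x * (1 - Real.exp (-x)) := by
        rw [mul_sub, ← Real.exp_add]
        simp only [add_neg_cancel, Real.exp_zero, mul_one]
        linarith [Real.add_one_le_exp x]
      have h3 : 0 ≤ 1 - Real.exp (-x) :=
        sub_nonneg.2 (Real.exp_le_one_iff.2 (neg_nonpos.2 hx0))
      exact h2.trans (mul_le_mul_of_nonneg_right (Real.exp_le_exp.2 hxμ) h3)
    have e3 : β' - β = x / μ := by rw [hx]; field_simp
    rw [e1, e3]
    calc C * (x / μ) * Real.exp (-μ * β)
        ≤ C * (Real.exp μ * (1 - Real.exp (-x)) / μ) * Real.exp (-μ * β) := by gcongr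
      _ = _ := by ring
  obtain ⟨k, hk⟩ := exists_nat_ge (β' - β)
  induction k generalizing β with
  | zero => exact short β β' hβ hle (by push_cast at hk; linarith)
  | succ k ih =>
    rcases le_total β' (β + 1) with h1 | h1
    · exact short β β' hβ hle h1
    · have i1 := short β (β + 1) hβ (by linarith) le_rfl
      have i2 := ih (β := β + 1) (by linarith) h1 (by push_cast at hk; linarith)
      have := norm_sub_le_norm_sub_add_norm_sub (f β) (f (β + 1)) (f β')
      linarith

theorem IsAssignmentSolution.of_tendsto_softassign {n : ℕ} {X S : Matrix (Fin n) (Fin n) ℝ}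
    (hS : Tendsto (fun β : ℝ => softassign β X) atTop (𝓝 S)) : IsAssignmentSolution X S := by
  have hmem : S ∈ doublyStochastic ℝ (Fin n) :=
    (isCompact_doublyStochastic n).isClosed.mem_of_tendsto hS
      (Eventually.of_forall fun β => (isSoftassign_softassign β X).1)
  have hc (i j : Fin n) : Continuous fun S : Matrix (Fin n) (Fin n) ℝ => S i j :=
    continuous_apply_apply i j
  have hscore : Continuous fun S : Matrix (Fin n) (Fin n) ℝ => assignScore S X :=
    continuous_finsetSum _ fun i _ => continuous_finsetSum _ fun j _ =>
      (hc i j).mul continuous_const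
  have hent : Continuous fun S : Matrix (Fin n) (Fin n) ℝ => matrixEntropy S :=
    Continuous.neg <| continuous_finsetSum _ fun i _ => continuous_finsetSum _ fun j _ =>
      Real.continuous_mul_log.comp (hc i j)
  have hinv : Tendsto (fun β : ℝ => 1 / β) atTop (𝓝 0) := by
    simpa using tendsto_inv_atTop_zero (𝕜 := ℝ)
  refine ⟨hmem, fun T hT => ?_⟩
  have hl : Tendsto (fun β : ℝ => entropicScore β X T) atTop (𝓝 (assignScore T X)) := by
    simpa [entropicScore] using (hinv.mul_const (matrixEntropy T)).const_add (assignScore T X)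
  have hr : Tendsto (fun β : ℝ => entropicScore β X (softassign β X)) atTop
      (𝓝 (assignScore S X)) := by
    simpa [entropicScore] using ((hscore.tendsto S).comp hS).add
      (hinv.mul ((hent.tendsto S).comp hS))
  exact le_of_tendsto_of_tendsto' hl hr fun β => (isSoftassign_softassign β X).2 T hT

theorem proposition2 (n : ℕ) (X : Matrix (Fin n) (Fin n) ℝ) :
    ∃ Sinf : Matrix (Fin n) (Fin n) ℝ,
      IsAssignmentSolution X Sinf ∧
      Tendsto (fun β : ℝ => softassign β X) atTop (𝓝 Sinf) ∧
      ∃ c μ : ℝ, 0 < c ∧ 0 < μ ∧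
        ∀ β : ℝ, 0 < β →
          (∀ Δβ : ℝ, 0 < Δβ →
            ‖softassign β X - softassign (β + Δβ) X‖ ≤
              (1 - Real.exp (-μ * Δβ)) * (c / μ) * Real.exp (-μ * β)) ∧
          ‖softassign β X - Sinf‖ ≤ c / μ * Real.exp (-μ * β) := by
  obtain ⟨C, μ, hC, hμ, hlip⟩ := exists_norm_softassign_sub_le X
  set c := C * Real.exp μ
  have hc : 0 < c := by positivity
  have hdiff : ∀ β β' : ℝ, 0 < β → β ≤ β' → ‖softassign β X - softassign β' X‖ ≤
      c / μ * (Real.exp (-μ * β) - Real.exp (-μ * β')) := fun β β' hβ hle =>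
    norm_sub_le_exp_sub_exp (f := fun β => softassign β X) hC.le hμ hlip hβ hle
  have hdiff' : ∀ β β' : ℝ, 0 < β → β ≤ β' → ‖softassign β X - softassign β' X‖ ≤
      c / μ * Real.exp (-μ * β) := fun β β' hβ hle =>
    (hdiff β β' hβ hle).trans (by gcongr; linarith [Real.exp_pos (-μ * β')])
  have hexp : Tendsto (fun k : ℕ => c / μ * Real.exp (-μ * (k + 1))) atTop (𝓝 0) := by
    have h1 : Tendsto (fun k : ℕ => μ * ((k : ℝ) + 1)) atTop atTop :=
      (tendsto_atTop_add_const_right _ _ tendsto_natCast_atTop_atTop).const_mul_atTop hμ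
    have h2 := (Real.tendsto_exp_neg_atTop_nhds_zero.comp h1).const_mul (c / μ)
    simpa [Function.comp_def] using h2
  -- Integer parameters, shifted by 1 to stay positive, give a Cauchy sequence in a compact set.
  obtain ⟨S, -, hS⟩ : ∃ S ∈ (doublyStochastic ℝ (Fin n) : Set (Matrix (Fin n) (Fin n) ℝ)),
      Tendsto (fun k : ℕ => softassign ((k : ℝ) + 1) X) atTop (𝓝 S) :=
    cauchySeq_tendsto_of_isComplete (isCompact_doublyStochastic n).isComplete
      (fun k => (isSoftassign_softassign _ X).1)
      (cauchySeq_of_le_tendsto_0' _ (fun k m hkm => by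
        rw [dist_eq_norm]
        exact hdiff' _ _ (by positivity) (by gcongr)) hexp)
  -- Let the second parameter tend to infinity along that sequence.
  have hbound : ∀ β : ℝ, 0 < β → ‖softassign β X - S‖ ≤ c / μ * Real.exp (-μ * β) := by
    intro β hβ
    refine le_of_tendsto (hS.const_sub (softassign β X)).norm ?_
    obtain ⟨N, hN⟩ := exists_nat_ge β
    filter_upwards [eventually_ge_atTop N] with k hk
    have : (N : ℝ) ≤ k := by exact_mod_cast hk
    exact hdiff' _ _ hβ (by linarith)
  have hlim : Tendsto (fun β : ℝ => softassign β X) atTop (𝓝 S) := by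
    refine tendsto_iff_norm_sub_tendsto_zero.2 ?_
    have hz : Tendsto (fun β : ℝ => c / μ * Real.exp (-μ * β)) atTop (𝓝 0) := by
      have h2 := (Real.tendsto_exp_neg_atTop_nhds_zero.comp
        (tendsto_id.const_mul_atTop hμ)).const_mul (c / μ)
      simpa [Function.comp_def] using h2
    exact squeeze_zero' (Eventually.of_forall fun _ => norm_nonneg _)
      ((eventually_gt_atTop 0).mono hbound) hz
  refine ⟨S, .of_tendsto_softassign hlim, hlim, c, μ, hc, hμ, fun β hβ =>
    ⟨fun Δβ hΔ => (hdiff β (β + Δβ) hβ (by linarith)).trans_eq ?_, hbound β hβ⟩⟩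
  rw [mul_add, Real.exp_add]
  ring
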